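/- Let $\mathfrak L^{\mathtt q}$ be the set of behaviors $\{v\in C^\infty(\mathbb R,\mathbb R^{\mathtt q})\mid R(\frac{d}{dt})v=0\}$, where $R$ is a real polynomial matrix with $\mathtt q$ columns; the equation $R(\frac{d}{dt})v=0$ is a kernel representation of the behavior. A set of components of $v$ is free in a behavior $\mathfrak B$ if these components can be prescribed as arbitrary smooth functions and completed to an element of $\mathfrak B$. An input-output partition of $\mathfrak B$ takes a maximal free set of components as the input and the remaining components as the output, and the output cardinality $\mathtt p(\mathfrak B)$ is the number of output components in such a partition (for $\mathfrak B\in\mathfrak L^{\mathtt q}$ it does not depend on the partition). The interconnection of $\mathfrak B_1$ (variables $(x,z)$) and $\mathfrak B_2$ (variables $(y,z)$) through $z$ is $\mathfrak B_1\wedge_z\mathfrak B_2=\{(x,y,z)\mid (x,z)\in\mathfrak B_1,\ (y,z)\in\mathfrak B_2\}$; it is regular if $\mathtt p(\mathfrak B_1\wedge_z\mathfrak B_2)=\mathtt p(\mathfrak B_1)+\mathtt p(\mathfrak B_2)$. For $i=1,2$ let $\mathcal P_i\in\mathfrak L^{\mathtt w_i+\mathtt s+\mathtt c_i}$ (variables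 $(w_i,s,c_i)$) and $\mathcal K_i\in\mathfrak L^{\mathtt w_i+\mathtt k}$ (variables $(w_i,k)$) have kernel representations $$R_i(\tfrac{d}{dt})w_i+S_i(\tfrac{d}{dt})s+M_i(\tfrac{d}{dt})c_i=0,\qquad W_i(\tfrac{d}{dt})w_i+K_i(\tfrac{d}{dt})k=0,$$ with real polynomial matrices $R_i,S_i,M_i,W_i,K_i$, and define the local canonical controller $$\mathcal C_i^{\mathrm{can}}=\{(c_i,s,k)\mid \exists\, w_i:\ (w_i,s,c_i)\in\mathcal P_i \text{ and } (w_i,k)\in\mathcal K_i\}.$$ Put $$L_1=\begin{bmatrix}M_1&0&S_1&0\\0&0&0&K_1\end{bmatrix},\quad N_1=\begin{bmatrix}R_1&0\\W_1&0\end{bmatrix},\quad L_2=\begin{bmatrix}0&M_2&S_2&0\\0&0&0&K_2\end{bmatrix},\quad N_2=\begin{bmatrix}0&R_2\\0&W_2\end{bmatrix},$$ where the columns of the $L_i$ correspond to $(c_1,c_2,s,k)$ and those of the $N_i$ to $(w_1,w_2)$. Then the interconnection of $\mathcal C_1^{\mathrm{can}}$ and $\mathcal C_2^{\mathrm{can}}$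 through $(s,k)$ is regular if and only if $$\operatorname{rank}\begin{bmatrix}L_1&N_1\end{bmatrix}+\operatorname{rank}\begin{bmatrix}L_2&N_2\end{bmatrix}=\operatorname{rank}\begin{bmatrix}L_1&N_1\\L_2&N_2\end{bmatrix},$$ where $\operatorname{rank}$ denotes the rank of a polynomial matrix (over $\mathbb R[\xi]$, equivalently over $\mathbb R(\xi)$). -/

import Mathlib

open scoped Polynomial ContDiff

namespace Behavioral

/-- Trajectories over the time axis `ℝ` whose components are indexed by `ι`,
that is, functions from `ℝ` to `ℝ^ι`. -/
abbrev Traj (ι : Type*) := ℝ → ι → ℝ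

/-- `col x y` is the trajectory `(x, y)`. -/
def col {α β : Type*} (x : Traj α) (y : Traj β) : Traj (α ⊕ β) :=
  fun t => Sum.elim (x t) (y t)

/-- `R(d/dt) w` for a polynomial matrix `R`. -/
noncomputable def diffOp {m n : Type*} [Fintype n] (R : Matrix m n ℝ[X]) (w : Traj n) : Traj m :=
  fun t i => ∑ j, (R i j).sum fun d a => a * iteratedDeriv d (fun τ => w τ j) t

/-- The linear differential system with kernel representation `R(d/dt) w = 0`:
all smooth `w` that satisfy this equation. -/
def kernelBehavior {m n : Type*} [Fintype n] (R : Matrix m n ℝ[X]) : Set (Traj n) :=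
  {w | ContDiff ℝ ∞ w ∧ diffOp R w = 0}

/-- The components with index in `I` are free in `B`: they can be prescribed as arbitrary smooth
functions. (The components of `u` outside `I` play no role.) -/
def IsFree {ι : Type*} [Fintype ι] (B : Set (Traj ι)) (I : Set ι) : Prop :=
  ∀ u : Traj ι, ContDiff ℝ ∞ u → ∃ w ∈ B, ∀ i ∈ I, ∀ t, w t i = u t i

/-- `w = (u, y)`, with `u` the components in `I` and `y` the components outside `I`, is an
input-output partition of `B`: `u` is free, and `y` contains no further free components. -/
def IsInputOutputPartition {ι : Type*} [Fintype ι] (B : Set (Traj ι)) (I : Set ι) : Prop :=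
  Maximal (IsFree B) I

/-- The output cardinality `p(B)`, the number of output components in an input-output partition.
For the behaviors considered here, this number does not depend on the partition; the infimum
just picks it. -/
noncomputable def outputCard {ι : Type*} [Fintype ι] (B : Set (Traj ι)) : ℕ :=
  sInf {p | ∃ I : Set ι, IsInputOutputPartition B I ∧ p = Iᶜ.ncard}

/-- The interconnection through the shared variable `z`:
all `(x, y, z)` with `(x, z) ∈ B₁` and `(y, z) ∈ B₂`. -/
def interconnection {α β σ : Type*} (B₁ : Set (Traj (α ⊕ σ))) (B₂ : Set (Traj (β ⊕ σ))) :
    Set (Traj (α ⊕ β ⊕ σ)) :=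
  {v | ∃ (x : Traj α) (y : Traj β) (z : Traj σ),
    v = col x (col y z) ∧ col x z ∈ B₁ ∧ col y z ∈ B₂}

/-- The interconnection of `B₁` and `B₂` through their shared variable is regular. -/
def IsRegularInterconnection {α β σ : Type*} [Fintype α] [Fintype β] [Fintype σ]
    (B₁ : Set (Traj (α ⊕ σ))) (B₂ : Set (Traj (β ⊕ σ))) : Prop :=
  outputCard (interconnection B₁ B₂) = outputCard B₁ + outputCard B₂

/-- The local canonical controller: all `(c, s, k)` for which there is a `w` with
`(w, s, c) ∈ P` and `(w, k) ∈ K`. -/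
def canonicalController {ν σ γ κ : Type*} (P : Set (Traj (ν ⊕ σ ⊕ γ))) (K : Set (Traj (ν ⊕ κ))) :
    Set (Traj (γ ⊕ σ ⊕ κ)) :=
  {v | ∃ (c : Traj γ) (s : Traj σ) (k : Traj κ) (w : Traj ν),
    v = col c (col s k) ∧ col w (col s c) ∈ P ∧ col w k ∈ K}

section Blocks

variable {g h γ₁ γ₂ σ κ ν₁ ν₂ : Type*}

/-- `L₁`, with rows `[M₁ 0 S₁ 0]` and `[0 0 0 K₁]`; the columns belong to `c₁, c₂, s, k`. -/
noncomputable def blockL₁ (M₁ : Matrix g γ₁ ℝ[X]) (S₁ : Matrix g σ ℝ[X]) (K₁ : Matrix h κ ℝ[X]) :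
    Matrix (g ⊕ h) (γ₁ ⊕ γ₂ ⊕ σ ⊕ κ) ℝ[X] :=
  Matrix.fromRows
    (Matrix.fromCols M₁ (Matrix.fromCols 0 (Matrix.fromCols S₁ 0)))
    (Matrix.fromCols 0 (Matrix.fromCols 0 (Matrix.fromCols 0 K₁)))

/-- `L₂`, with rows `[0 M₂ S₂ 0]` and `[0 0 0 K₂]`; the columns belong to `c₁, c₂, s, k`. -/
noncomputable def blockL₂ (M₂ : Matrix g γ₂ ℝ[X]) (S₂ : Matrix g σ ℝ[X]) (K₂ : Matrix h κ ℝ[X]) :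
    Matrix (g ⊕ h) (γ₁ ⊕ γ₂ ⊕ σ ⊕ κ) ℝ[X] :=
  Matrix.fromRows
    (Matrix.fromCols 0 (Matrix.fromCols M₂ (Matrix.fromCols S₂ 0)))
    (Matrix.fromCols 0 (Matrix.fromCols 0 (Matrix.fromCols 0 K₂)))

/-- `N₁`, with rows `[R₁ 0]` and `[W₁ 0]`; the columns belong to `w₁, w₂`. -/
noncomputable def blockN₁ (R₁ : Matrix g ν₁ ℝ[X]) (W₁ : Matrix h ν₁ ℝ[X]) :
    Matrix (g ⊕ h) (ν₁ ⊕ ν₂) ℝ[X] :=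
  Matrix.fromBlocks R₁ 0 W₁ 0

/-- `N₂`, with rows `[0 R₂]` and `[0 W₂]`; the columns belong to `w₁, w₂`. -/
noncomputable def blockN₂ (R₂ : Matrix g ν₂ ℝ[X]) (W₂ : Matrix h ν₂ ℝ[X]) :
    Matrix (g ⊕ h) (ν₁ ⊕ ν₂) ℝ[X] :=
  Matrix.fromBlocks 0 R₂ 0 W₂

end Blocks

end Behavioral

/-! Each canonical controller, and also their interconnection, is the projection of a kernel
behavior `[L N] (l, w) = 0` to `l`. For such a projection the output cardinality is `rank [L N] -
rank N` (`outputCard_projBehavior_add`). For the interconnection, `N` is block diagonal up to its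
zero blocks, so its rank is the sum of the two local ranks of `N`; these terms cancel from the
regularity condition and the rank equation remains.

The output cardinality formula needs no kernel representation of the projection. Every nonzero
scalar operator `p(d/dt)` is onto, so the smooth functions form a divisible, hence injective,
`ℝ[X]`-module, and a linear system over them is solvable as soon as its syzygies permit. Therefore
`I` is free exactly when no nonzero consequence `r [L N]` of the equations is supported on `I`
(`isFree_projBehavior_iff`). By duality over `ℝ(ξ)` this says that, modulo the columns of `N`, the
columns of `L` outside `I` span all columns of `L` (`span_mkQ_eq_iff`). The outputs of a partition
thus index a basis of this quotient span. -/

namespace Behavioral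

open Polynomial

/-! ### Surjectivity of scalar differential operators -/

/-- The smooth functions `ℝ → 𝕜`. -/
def smoothFun (𝕜 : Type*) [RCLike 𝕜] : Submodule 𝕜 (ℝ → 𝕜) where
  carrier := {f | ContDiff ℝ ∞ f}
  add_mem' {f g} (hf : ContDiff ℝ ∞ f) (hg : ContDiff ℝ ∞ g) :=
    show ContDiff ℝ ∞ (f + g) from hf.add hg
  zero_mem' := show ContDiff ℝ ∞ fun _ : ℝ => (0 : 𝕜) from contDiff_const
  smul_mem' c f (hf : ContDiff ℝ ∞ f) :=
    show ContDiff ℝ ∞ fun t => c * f t from contDiff_const.mul hf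

/-- Differentiation as an endomorphism of the space of smooth functions. -/
noncomputable def smoothDeriv (𝕜 : Type*) [RCLike 𝕜] : Module.End 𝕜 (smoothFun 𝕜) where
  toFun f := ⟨deriv f.1, (contDiff_infty_iff_deriv.1 f.2).2⟩
  map_add' f g := by
    ext t
    exact deriv_add ((contDiff_infty_iff_deriv.1 f.2).1 t) ((contDiff_infty_iff_deriv.1 g.2).1 t)
  map_smul' c f := by
    ext t
    exact deriv_const_mul c ((contDiff_infty_iff_deriv.1 f.2).1 t)

/-- Variation of constants: `exp (c t) * ∫₀ᵗ exp (-c s) f s ds` solves `u' - c u = f`. -/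
lemma smoothDeriv_sub_surjective (c : ℂ) :
    Function.Surjective (smoothDeriv ℂ - algebraMap ℂ (Module.End ℂ (smoothFun ℂ)) c) := by
  rintro ⟨f, hf : ContDiff ℝ ∞ f⟩
  have he (c : ℂ) : ContDiff ℝ ∞ fun t : ℝ => Complex.exp (c * t) :=
    (contDiff_const.mul Complex.ofRealCLM.contDiff).cexp
  set h : ℝ → ℂ := fun s => Complex.exp (-c * s) * f s with hh
  have hs : ContDiff ℝ ∞ h := (he (-c)).mul hf
  set g : ℝ → ℂ := fun t => ∫ s in (0 : ℝ)..t, h s with hg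
  have hd (t : ℝ) : HasDerivAt g (h t) t :=
    (hs.continuous).integral_hasStrictDerivAt 0 t |>.hasDerivAt
  have hgs : ContDiff ℝ ∞ g := by
    refine contDiff_infty_iff_deriv.2 ⟨fun t => (hd t).differentiableAt, ?_⟩
    rw [show deriv g = h from funext fun t => (hd t).deriv]
    exact hs
  refine ⟨⟨fun t => Complex.exp (c * t) * g t, (he c).mul hgs⟩, ?_⟩
  ext t
  have h1 : HasDerivAt (fun t : ℝ => Complex.exp (c * t)) (Complex.exp (c * t) * (c * 1)) t :=
    ((Complex.ofRealCLM.hasDerivAt (x := t)).const_mul c).cexp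
  have h2 := (h1.mul (hd t)).deriv
  change deriv (fun t : ℝ => Complex.exp (c * t) * g t) t - c * (Complex.exp (c * t) * g t) = f t
  refine (congrArg (· - c * (Complex.exp (c * t) * g t)) h2).trans ?_
  have h3 : Complex.exp (c * t) * Complex.exp (-c * t) = 1 := by
    rw [← Complex.exp_add]; simp
  simp only [hh]
  linear_combination f t * h3

/-- Over `ℂ` the operator is a nonzero constant times a composition of first-order factors. -/
lemma aeval_smoothDeriv_complex_surjective {p : ℂ[X]} (hp : p ≠ 0) :
    Function.Surjective (aeval (smoothDeriv ℂ) p) := by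
  have key (s : Multiset ℂ) :
      Function.Surjective (aeval (smoothDeriv ℂ) (s.map fun a => X - C a).prod) := by
    induction s using Multiset.induction with
    | empty => exact fun x => ⟨x, by simp⟩
    | cons a s ih =>
      rw [Multiset.map_cons, Multiset.prod_cons, map_mul, Module.End.coe_mul, map_sub, aeval_X,
        aeval_C]
      exact (smoothDeriv_sub_surjective a).comp ih
  rw [(IsAlgClosed.splits p).eq_prod_roots, map_mul, Module.End.coe_mul]
  refine Function.Surjective.comp ?_ (key p.roots)
  intro f
  refine ⟨p.leadingCoeff⁻¹ • f, ?_⟩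
  simp [hp]

/-- The real part of a smooth function. -/
noncomputable def smoothRe : smoothFun ℂ →ₗ[ℝ] smoothFun ℝ where
  toFun f := ⟨fun t => (f.1 t).re, Complex.reCLM.contDiff.comp (show ContDiff ℝ ∞ f.1 from f.2)⟩
  map_add' f g := by ext t; simp
  map_smul' c f := by ext t; simp

lemma smoothRe_smoothDeriv (f : smoothFun ℂ) :
    smoothRe (smoothDeriv ℂ f) = smoothDeriv ℝ (smoothRe f) := by
  ext t
  have h : HasDerivAt f.1 (deriv f.1 t) t := ((contDiff_infty_iff_deriv.1 f.2).1 t).hasDerivAt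
  exact ((Complex.reCLM.hasFDerivAt.comp_hasDerivAt t h).deriv).symm

lemma smoothRe_aeval (p : ℝ[X]) (f : smoothFun ℂ) :
    smoothRe (aeval (smoothDeriv ℂ) (p.map (algebraMap ℝ ℂ)) f) =
      aeval (smoothDeriv ℝ) p (smoothRe f) := by
  induction p using Polynomial.induction_on' generalizing f with
  | add p q hp hq =>
    rw [Polynomial.map_add, map_add, map_add, LinearMap.add_apply, LinearMap.add_apply, map_add,
      hp, hq]
  | monomial n a =>
    induction n generalizing f with
    | zero =>
      ext t
      simp [smoothRe]
    | succ n ih =>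
      rw [← monomial_mul_X, Polynomial.map_mul, map_mul, map_mul, map_X, aeval_X, aeval_X,
        Module.End.mul_apply, Module.End.mul_apply, ih, smoothRe_smoothDeriv]

/-- A real operator commutes with taking real parts, so the real part of a complex solution is a
solution. -/
lemma aeval_smoothDeriv_surjective {p : ℝ[X]} (hp : p ≠ 0) :
    Function.Surjective (aeval (smoothDeriv ℝ) p) := by
  rintro ⟨f, hf : ContDiff ℝ ∞ f⟩
  obtain ⟨x, hx⟩ := aeval_smoothDeriv_complex_surjective
    (Polynomial.map_ne_zero (f := algebraMap ℝ ℂ) hp)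
    ⟨fun t => (f t : ℂ), Complex.ofRealCLM.contDiff.comp hf⟩
  refine ⟨smoothRe x, ?_⟩
  rw [← smoothRe_aeval, hx]
  ext t
  simp [smoothRe]

/-! ### Injectivity of the smooth functions and solvability of linear systems -/

/-- The smooth functions as a module over `ℝ[X]`, with `X` acting by differentiation. -/
abbrev SmoothModule : Type := Module.AEval' (smoothDeriv ℝ)

/-- A divisible module over a principal ideal ring satisfies Baer's criterion. -/
lemma baer_of_divisible {R Q : Type*} [CommRing R] [IsPrincipalIdealRing R] [AddCommGroup Q]
    [Module R Q] (h : ∀ r : R, r ≠ 0 → ∀ q : Q, ∃ x, r • x = q) : Module.Baer R Q := by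
  intro I g
  obtain ⟨a, rfl⟩ := (IsPrincipalIdealRing.principal I).principal
  by_cases ha : a = 0
  · refine ⟨0, fun x hx => ?_⟩
    subst ha
    have : (⟨x, hx⟩ : Submodule.span R {(0 : R)}) = 0 := by
      ext
      simpa using hx
    rw [this, map_zero, LinearMap.zero_apply]
  -- A map on the ideal `(a)` is determined by its value at `a`; dividing that value by `a` gives
  -- the image of `1` for the extension.
  · obtain ⟨q, hq⟩ := h a ha (g ⟨a, Submodule.mem_span_singleton_self a⟩)
    refine ⟨LinearMap.toSpanSingleton R Q q, fun x hx => ?_⟩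
    obtain ⟨r, rfl⟩ := Submodule.mem_span_singleton.1 hx
    rw [LinearMap.toSpanSingleton_apply, smul_assoc, hq, ← map_smul]
    rfl

lemma smoothModule_baer : Module.Baer ℝ[X] SmoothModule :=
  baer_of_divisible fun _ hp f => aeval_smoothDeriv_surjective hp f

/-- Over a module satisfying Baer's criterion, the compatibility conditions given by the left
syzygies of `P` are sufficient for solving the linear system `P x = f`. -/
lemma exists_solution_of_baer {R : Type*} {Q : Type*} {m n : Type*} [CommRing R] [AddCommGroup Q]
    [Module R Q] [Small.{0} R] [Fintype m] [Fintype n] (hQ : Module.Baer R Q)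
    (P : Matrix m n R) (f : m → Q)
    (h : ∀ r : m → R, Matrix.vecMul r P = 0 → ∑ i, r i • f i = 0) :
    ∃ x : n → Q, ∀ i, ∑ j, P i j • x j = f i := by
  classical
  -- By the compatibility condition, `r ↦ ∑ rᵢ fᵢ` factors through `r ↦ r P`. An extension `H` of
  -- the factored map to all of `Rⁿ` yields the solution `xⱼ = H eⱼ`.
  let F : (m → R) →ₗ[R] Q := Fintype.linearCombination R f
  have hF : LinearMap.ker P.vecMulLinear ≤ LinearMap.ker F := fun r hr => by
    simpa [F, Fintype.linearCombination_apply] using h r (by simpa using hr)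
  let e := P.vecMulLinear.quotKerEquivRange
  let g : LinearMap.range P.vecMulLinear →ₗ[R] Q :=
    (Submodule.liftQ _ F hF) ∘ₗ e.symm.toLinearMap
  obtain ⟨H, hH⟩ := hQ.extension_property (LinearMap.range P.vecMulLinear).subtype
    (Submodule.injective_subtype _) g
  have hr (r : m → R) : H (Matrix.vecMul r P) = F r := by
    have := LinearMap.congr_fun hH ⟨Matrix.vecMul r P, r, rfl⟩
    refine this.trans ?_
    have h2 : e.symm ⟨Matrix.vecMul r P, r, rfl⟩ = Submodule.Quotient.mk r := by
      rw [LinearEquiv.symm_apply_eq]; rfl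
    simp [g, h2]
  refine ⟨fun j => H (Pi.single j 1), fun i => ?_⟩
  have := hr (Pi.single i 1)
  simp only [F, Fintype.linearCombination_apply_single, one_smul, Matrix.single_one_vecMul] at this
  rw [← this]
  conv_rhs => rw [pi_eq_sum_univ' (P.row i), map_sum]
  simp [map_smul, Matrix.row]
lemma coe_aeval_smoothDeriv (p : ℝ[X]) (f : smoothFun ℝ) (t : ℝ) :
    (aeval (smoothDeriv ℝ) p f).1 t = p.sum fun d a => a * iteratedDeriv d f.1 t := by
  have h (d : ℕ) (f : smoothFun ℝ) : ((smoothDeriv ℝ ^ d) f).1 = iteratedDeriv d f.1 := by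
    induction d with
    | zero => simp
    | succ d ih =>
      rw [pow_succ', Module.End.mul_apply, iteratedDeriv_succ, ← ih]
      rfl
  rw [aeval_eq_sum_range, sum_over_range _ (by simp)]
  simp [h]

/-! ### Free variables and consequences of the equations -/

/-- The behavior of the first variables of a linear differential system, the other variables
being eliminated. -/
def projBehavior {m ι ν : Type*} [Fintype ι] [Fintype ν] (A : Matrix m (ι ⊕ ν) ℝ[X]) :
    Set (Traj ι) :=
  {l | ∃ w : Traj ν, col l w ∈ kernelBehavior A}

/-- The trajectory whose components are the given smooth functions. -/
noncomputable def ofSmooth {n : Type*} (x : n → SmoothModule) : Traj n := fun t j =>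
  ((Module.AEval'.of (smoothDeriv ℝ)).symm (x j)).1 t

lemma contDiff_ofSmooth {n : Type*} [Fintype n] (x : n → SmoothModule) :
    ContDiff ℝ ∞ (ofSmooth x) :=
  contDiff_pi.2 fun j => ((Module.AEval'.of (smoothDeriv ℝ)).symm (x j)).2

lemma exists_ofSmooth {n : Type*} [Fintype n] {w : Traj n} (hw : ContDiff ℝ ∞ w) :
    ∃ x, ofSmooth x = w :=
  ⟨fun j => Module.AEval'.of (smoothDeriv ℝ) ⟨fun t => w t j, contDiff_pi.1 hw j⟩, rfl⟩

lemma ofSmooth_injective {n : Type*} : Function.Injective (ofSmooth (n := n)) := by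
  intro x y h
  funext j
  apply (Module.AEval'.of (smoothDeriv ℝ)).symm.injective
  ext t
  exact congrFun (congrFun h t) j

lemma diffOp_ofSmooth {m n : Type*} [Fintype n] (A : Matrix m n ℝ[X]) (x : n → SmoothModule) :
    diffOp A (ofSmooth x) = ofSmooth fun i => ∑ j, A i j • x j := by
  funext t i
  simp only [diffOp, ofSmooth, map_sum, Module.AEval.of_symm_smul]
  rw [AddSubmonoidClass.coe_finsetSum, Finset.sum_apply]
  exact Finset.sum_congr rfl fun j _ => (coe_aeval_smoothDeriv _ _ _).symm

lemma ofSmooth_mem_kernelBehavior {m n : Type*} [Fintype n] {A : Matrix m n ℝ[X]}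
    {x : n → SmoothModule} :
    ofSmooth x ∈ kernelBehavior A ↔ ∀ i, ∑ j, A i j • x j = 0 := by
  refine Iff.trans (b := diffOp A (ofSmooth x) = 0) ⟨And.right, fun h => ⟨contDiff_ofSmooth x, h⟩⟩ ?_
  rw [diffOp_ofSmooth, show (0 : Traj m) = ofSmooth (fun _ => 0) from rfl,
    ofSmooth_injective.eq_iff, funext_iff]

lemma sum_smul_sum_smul {R Q m n : Type*} [CommRing R] [AddCommGroup Q] [Module R Q] [Fintype m]
    [Fintype n] (r : m → R) (A : Matrix m n R) (x : n → Q) :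
    ∑ i, r i • ∑ j, A i j • x j = ∑ j, Matrix.vecMul r A j • x j := by
  simp only [Finset.smul_sum, smul_smul]
  rw [Finset.sum_comm]
  simp [Matrix.vecMul, dotProduct, Finset.sum_smul]

/-- The components in `S` of a solution of `A z = 0` can be prescribed if every equation implied by
the system in which only these components occur is trivial. -/
lemma exists_extension_of_baer {R Q m n : Type*} [CommRing R] [AddCommGroup Q] [Module R Q]
    [Small.{0} R] [Fintype m] [Fintype n] (hQ : Module.Baer R Q) (A : Matrix m n R) (S : Set n)
    (h : ∀ r : m → R, (∀ j ∉ S, Matrix.vecMul r A j = 0) → Matrix.vecMul r A = 0) (y : n → Q) :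
    ∃ z : n → Q, (∀ j ∈ S, z j = y j) ∧ ∀ i, ∑ j, A i j • z j = 0 := by
  classical
  -- The prescribed components move to the right-hand side. A syzygy of the remaining columns `P`
  -- annihilates all of `A` by `h`, so the compatibility condition holds.
  let y' : n → Q := fun j => if j ∈ S then y j else 0
  let P : Matrix m n R := fun i j => if j ∈ S then 0 else A i j
  obtain ⟨x, hx⟩ := exists_solution_of_baer hQ P
    (fun i => -∑ j, A i j • y' j) (fun r hr => by
      have h0 := h r fun j hj => by
        refine Eq.trans ?_ (congrFun hr j)
        simp only [P, Matrix.vecMul, dotProduct, if_neg hj]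
      simp only [smul_neg]
      rw [Finset.sum_neg_distrib, sum_smul_sum_smul, h0]
      simp)
  refine ⟨fun j => if j ∈ S then y j else x j, fun j hj => if_pos hj, fun i => ?_⟩
  rw [← add_neg_cancel (∑ j, A i j • y' j), ← hx, ← Finset.sum_add_distrib]
  refine Finset.sum_congr rfl fun j _ => ?_
  by_cases hj : j ∈ S <;> simp [y', P, hj]

/-- A set of variables is free if and only if every equation implied by the system in which only
these variables occur is trivial. -/
lemma isFree_projBehavior_iff {m ι ν : Type*} [Fintype m] [Fintype ι] [Fintype ν]
    (A : Matrix m (ι ⊕ ν) ℝ[X]) (I : Set ι) :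
    IsFree (projBehavior A) I ↔ ∀ r : m → ℝ[X], (∀ j ∉ Sum.inl '' I, Matrix.vecMul r A j = 0) →
      Matrix.vecMul r A = 0 := by
  classical
  constructor
  · intro hI r hr
    funext j
    by_cases hj : j ∈ Sum.inl '' I
    swap
    · exact hr j hj
    obtain ⟨i, hi, rfl⟩ := hj
    by_contra hp
    -- Prescribing `v` at `i` and `0` elsewhere on `I` reduces the consequence `(r A) x = 0` to its
    -- single term at `i`.
    have hzero (v : SmoothModule) : Matrix.vecMul r A (Sum.inl i) • v = 0 := by
      obtain ⟨l, ⟨w, hw⟩, hl⟩ := hI (ofSmooth (Pi.single i v)) (contDiff_ofSmooth _)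
      obtain ⟨x, hx⟩ := exists_ofSmooth hw.1
      rw [← hx, ofSmooth_mem_kernelBehavior] at hw
      have h0 := sum_smul_sum_smul r A x
      simp only [hw, smul_zero, Finset.sum_const_zero] at h0
      have hxI (k : ι) (hk : k ∈ I) : x (Sum.inl k) = (Pi.single i v : ι → SmoothModule) k := by
        apply (Module.AEval'.of (smoothDeriv ℝ)).symm.injective
        ext t
        have h1 := congrFun (congrFun hx t) (Sum.inl k)
        exact h1.trans (hl k hk t)
      rw [h0, Finset.sum_eq_single (Sum.inl i), hxI i hi, Pi.single_eq_same]
      · intro j _ hji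
        by_cases hj : j ∈ Sum.inl '' I
        · obtain ⟨k, hk, rfl⟩ := hj
          rw [hxI k hk, Pi.single_eq_of_ne (fun h => hji (congrArg Sum.inl h)), smul_zero]
        · rw [hr j hj, zero_smul]
      · simp
    -- The nonzero coefficient acts surjectively, so it cannot annihilate every `v`: the constant
    -- `1` is in its image.
    have hone : ContDiff ℝ ∞ fun _ : ℝ => (1 : ℝ) := contDiff_const
    obtain ⟨v, hv⟩ := aeval_smoothDeriv_surjective hp ⟨fun _ => 1, hone⟩
    have h1 : (⟨fun _ => 1, hone⟩ : smoothFun ℝ) = 0 := hv.symm.trans (hzero v)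
    exact one_ne_zero (congrFun (congrArg Subtype.val h1) 0)
  · intro h u hu
    obtain ⟨y, rfl⟩ := exists_ofSmooth hu
    obtain ⟨z, hzy, hz⟩ := exists_extension_of_baer smoothModule_baer A (Sum.inl '' I) h
      (Sum.elim y 0)
    refine ⟨ofSmooth (z ∘ Sum.inl), ⟨ofSmooth (z ∘ Sum.inr), ?_⟩, fun i hi t => ?_⟩
    · convert! ofSmooth_mem_kernelBehavior.2 hz using 1
      funext t j
      rcases j with j | j <;> rfl
    · simp [ofSmooth, hzy (Sum.inl i) ⟨i, hi, rfl⟩]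

/-! ### Output cardinality as a dimension -/

section LinearAlgebra

variable {K V ι : Type*} [Field K] [AddCommGroup V] [Module K V]

/-- The complement of a minimal spanning subfamily has the dimension of the span as cardinality. -/
lemma ncard_compl_of_maximal [Fintype ι] (b : ι → V) {I : Set ι}
    (hI : Maximal (fun I : Set ι => Submodule.span K (b '' Iᶜ) = Submodule.span K (Set.range b)) I) :
    Iᶜ.ncard = Module.finrank K (Submodule.span K (Set.range b)) := by
  classical
  -- If some `b i` with `i ∉ I` depended on the others outside `I`, then `i` could be added to `I`,
  -- against maximality. So `Iᶜ` indexes a basis of the span.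
  have hli : LinearIndepOn K b Iᶜ := by
    rw [linearIndepOn_iff_notMem_span]
    intro i hi hmem
    refine hi (hI.le_of_ge (y := insert i I) ?_ (Set.subset_insert i I) (Set.mem_insert i I))
    rw [← hI.prop]
    refine le_antisymm (Submodule.span_mono (Set.image_mono
      (Set.compl_subset_compl.2 (Set.subset_insert i I)))) (Submodule.span_le.2 ?_)
    have he : (insert i I)ᶜ = Iᶜ \ {i} := by
      ext x
      simp [and_comm]
    rw [he]
    rintro _ ⟨j, hj, rfl⟩
    by_cases hji : j = i
    · exact hji ▸ hmem
    · exact Submodule.subset_span ⟨j, ⟨hj, hji⟩, rfl⟩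
  rw [← hI.prop, Set.image_eq_range, finrank_span_eq_card hli, ← Nat.card_eq_fintype_card,
    Nat.card_coe_set_eq]

/-- All maximal free sets have complements of the same size, and one exists because `∅` is free and
the index set is finite. The infimum is thus over a singleton. -/
lemma outputCard_eq_finrank [Fintype ι] (B : Set (Traj ι)) (b : ι → V)
    (h : ∀ I, IsFree B I ↔ Submodule.span K (b '' Iᶜ) = Submodule.span K (Set.range b)) :
    outputCard B = Module.finrank K (Submodule.span K (Set.range b)) := by
  have hfun : IsFree B =
      fun I : Set ι => Submodule.span K (b '' Iᶜ) = Submodule.span K (Set.range b) :=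
    funext fun I => propext (h I)
  have hset : {p | ∃ I : Set ι, IsInputOutputPartition B I ∧ p = Iᶜ.ncard} =
      {Module.finrank K (Submodule.span K (Set.range b))} := by
    refine Set.Subset.antisymm ?_ ?_
    · rintro _ ⟨I, hI, rfl⟩
      rw [IsInputOutputPartition, hfun] at hI
      exact ncard_compl_of_maximal b hI
    · rintro _ rfl
      obtain ⟨I, -, hI⟩ := (Set.toFinite {I | IsFree B I}).exists_le_maximal
        (a := ∅) ((h ∅).2 (by simp))
      refine ⟨I, hI, ?_⟩
      have hI' : Maximal (IsFree B) I := hI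
      rw [hfun] at hI'
      exact (ncard_compl_of_maximal b hI').symm
  rw [outputCard, hset, csInf_singleton]

/-- The dimension of the span of a family modulo the span of another one. -/
lemma finrank_span_mkQ {ν : Type*} [FiniteDimensional K V] (a : ι ⊕ ν → V) :
    Module.finrank K (Submodule.span K (Set.range
        ((Submodule.span K (Set.range (a ∘ Sum.inr))).mkQ ∘ a ∘ Sum.inl))) +
      Module.finrank K (Submodule.span K (Set.range (a ∘ Sum.inr))) =
    Module.finrank K (Submodule.span K (Set.range a)) := by
  set U := Submodule.span K (Set.range (a ∘ Sum.inr))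
  set W := Submodule.span K (Set.range a)
  have hUW : U ≤ W := Submodule.span_mono (Set.range_comp_subset_range _ _)
  have h1 : Submodule.span K (Set.range (U.mkQ ∘ a ∘ Sum.inl)) =
      -- Rank-nullity applies to `W → V / U`, whose kernel is `U` since `U ≤ W`.
      LinearMap.range (U.mkQ ∘ₗ W.subtype) := by
    rw [LinearMap.range_comp, Submodule.range_subtype]
    refine le_antisymm (Submodule.span_le.2 ?_) ?_
    · rintro _ ⟨i, rfl⟩
      exact ⟨_, Submodule.subset_span ⟨_, rfl⟩, rfl⟩
    · rw [Submodule.map_span, Submodule.span_le]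
      rintro _ ⟨_, ⟨i | i, rfl⟩, rfl⟩
      · exact Submodule.subset_span ⟨i, rfl⟩
      · have : U.mkQ (a (Sum.inr i)) = 0 :=
          (Submodule.Quotient.mk_eq_zero U).2 (Submodule.subset_span ⟨i, rfl⟩)
        simp [this]
  have h2 : LinearMap.ker (U.mkQ ∘ₗ W.subtype) = U.comap W.subtype := by
    rw [LinearMap.ker_comp, Submodule.ker_mkQ]
  rw [h1, ← LinearMap.finrank_range_add_finrank_ker (U.mkQ ∘ₗ W.subtype), h2,
    (Submodule.comapSubtypeEquivOfLe hUW).finrank_eq]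

end LinearAlgebra

/-! ### Rank over the fraction field and duality -/

section Rank

variable {R : Type*} (K : Type*) [CommRing R] [Field K] [Algebra R K]
  [IsFractionRing R K] {m n ι ν : Type*}

/-- The rank of a matrix over a domain is the rank over its fraction field. -/
lemma rank_eq_finrank_span_map [Finite m] [Fintype n] (A : Matrix m n R) :
    A.rank = Module.finrank K (Submodule.span K (Set.range (A.map (algebraMap R K)).col)) := by
  let f : (m → R) →ₗ[R] (m → K) := .pi fun i => Algebra.linearMap R K ∘ₗ .proj i
  let p := Submodule.span R (Set.range A.col)
  have hp : p.localized' K (nonZeroDivisors R) f =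
      Submodule.span K (Set.range (A.map (algebraMap R K)).col) := by
    rw [Submodule.localized'_span, ← Set.range_comp]
    rfl
  rw [Matrix.rank_eq_finrank_span_cols, ← hp, IsFractionRing.finrank_right_eq (R := R) (S := K)]
  exact (IsLocalizedModule.finrank_eq (nonZeroDivisors R)
    (p.toLocalized' K (nonZeroDivisors R) f) le_rfl).symm

lemma rank_map_algebraMap [Finite m] [Fintype n] (A : Matrix m n R) :
    (A.map (algebraMap R K)).rank = A.rank := by
  rw [rank_eq_finrank_span_map K A, Matrix.rank_eq_finrank_span_cols]

/-- Vectors span a subspace exactly when each functional vanishing on them vanishes on it.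
Functionals on `Kᵐ` are row vectors, and clearing denominators puts them in `Rᵐ`. -/
lemma span_mkQ_eq_iff [IsDomain R] [Fintype m] (A : Matrix m (ι ⊕ ν) R) (I : Set ι) :
    let a := (A.map (algebraMap R K)).col
    let U := Submodule.span K (Set.range (a ∘ Sum.inr))
    let b := U.mkQ ∘ a ∘ Sum.inl
    Submodule.span K (b '' Iᶜ) = Submodule.span K (Set.range b) ↔
      ∀ r : m → R, (∀ j ∉ Sum.inl '' I, Matrix.vecMul r A j = 0) → Matrix.vecMul r A = 0 := by
  classical
  intro a U b
  have hdot (r : m → R) (j : ι ⊕ ν) :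
      Fintype.linearCombination K (fun i => algebraMap R K (r i)) (a j) =
        algebraMap R K (Matrix.vecMul r A j) := by
    simp [Fintype.linearCombination_apply, a, Matrix.vecMul, dotProduct, mul_comm, Matrix.col_apply]
  constructor
  · intro h r hr
    set φ : (m → K) →ₗ[K] K := Fintype.linearCombination K (fun i => algebraMap R K (r i))
    have hU : U ≤ LinearMap.ker φ := by
      refine Submodule.span_le.2 ?_
      rintro _ ⟨j, rfl⟩
      have := hdot r (Sum.inr j)
      rw [hr _ (by simp), map_zero] at this
      exact this
    have hb : Submodule.span K (b '' Iᶜ) ≤ LinearMap.ker (U.liftQ φ hU) := by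
      refine Submodule.span_le.2 ?_
      rintro _ ⟨j, hj, rfl⟩
      have := hdot r (Sum.inl j)
      rw [hr _ (by simpa using hj), map_zero] at this
      exact this
    funext j
    rcases j with j | j
    · have hm : b j ∈ LinearMap.ker (U.liftQ φ hU) :=
        hb (h ▸ Submodule.subset_span ⟨j, rfl⟩)
      have h0 : φ (a (Sum.inl j)) = 0 := hm
      rw [hdot] at h0
      exact (FaithfulSMul.algebraMap_eq_zero_iff R K).1 h0
    · exact hr _ (by simp)
  · intro h
    refine le_antisymm (Submodule.span_mono (Set.image_subset_range _ _)) (Submodule.span_le.2 ?_)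
    rintro _ ⟨i, rfl⟩
    by_contra hi
    -- `ψ` separates `b i` from the span of the `b j` with `j ∉ I`. With a common denominator `c`,
    -- the coordinates of `c • ψ ∘ U.mkQ` form the row `r`.
    obtain ⟨ψ, hψi, hψ⟩ := Submodule.exists_le_ker_of_notMem hi
    obtain ⟨c, hc⟩ := IsLocalization.exist_integer_multiples_of_finset (nonZeroDivisors R)
      (Finset.univ.image fun k : m => ψ (U.mkQ (Pi.single k 1)))
    choose r hr using fun k : m => hc _ (Finset.mem_image_of_mem _ (Finset.mem_univ k))
    have hφ (j : ι ⊕ ν) : algebraMap R K (Matrix.vecMul r A j) = (c : R) • ψ (U.mkQ (a j)) := by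
      rw [← hdot, Fintype.linearCombination_apply]
      conv_rhs => rw [pi_eq_sum_univ' (a j), map_sum, map_sum, Finset.smul_sum]
      refine Finset.sum_congr rfl fun k _ => ?_
      rw [hr, map_smul, map_smul, smul_comm]
    have h0 := h r fun j hj => by
      apply FaithfulSMul.algebraMap_injective R K
      rw [hφ, map_zero]
      rcases j with j | j
      · have : ψ (b j) = 0 := hψ (Submodule.subset_span ⟨j, fun hjI => hj ⟨j, hjI, rfl⟩, rfl⟩)
        change (c : R) • ψ (b j) = 0
        rw [this, smul_zero]
      · have : U.mkQ (a (Sum.inr j)) = 0 :=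
          (Submodule.Quotient.mk_eq_zero U).2 (Submodule.subset_span ⟨j, rfl⟩)
        rw [this, map_zero, smul_zero]
    have h1 := hφ (Sum.inl i)
    rw [h0, Pi.zero_apply, map_zero, eq_comm, Algebra.smul_def, mul_eq_zero,
      FaithfulSMul.algebraMap_eq_zero_iff R K] at h1
    exact h1.elim (nonZeroDivisors.coe_ne_zero c) hψi

end Rank

/-- The output cardinality of a behavior given by elimination of latent variables. -/
lemma outputCard_projBehavior_add {m ι ν : Type*} [Fintype m] [Fintype ι] [Fintype ν]
    (L : Matrix m ι ℝ[X]) (N : Matrix m ν ℝ[X]) :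
    outputCard (projBehavior (Matrix.fromCols L N)) + N.rank = (Matrix.fromCols L N).rank := by
  rw [outputCard_eq_finrank _ _ fun I => (isFree_projBehavior_iff _ I).trans
    (span_mkQ_eq_iff (RatFunc ℝ) (Matrix.fromCols L N) I).symm,
    rank_eq_finrank_span_map (RatFunc ℝ), rank_eq_finrank_span_map (RatFunc ℝ)]
  exact finrank_span_mkQ (K := RatFunc ℝ) _

/-! ### Ranks of block matrices -/

section Rank

variable {R m m' n n' : Type*}

/-- The range is the product of the two ranges. -/
lemma rank_fromBlocks_zero_of_field [Field R] [Finite m] [Finite m'] [Fintype n] [Fintype n']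
    (A : Matrix m n R) (D : Matrix m' n' R) :
    (Matrix.fromBlocks A 0 0 D).rank = A.rank + D.rank := by
  let e := LinearEquiv.sumArrowLequivProdArrow m m' R R
  have h : (LinearMap.range (Matrix.fromBlocks A 0 0 D).mulVecLin).map e.toLinearMap =
      LinearMap.range (A.mulVecLin.prodMap D.mulVecLin) := by
    ext ⟨x, y⟩
    constructor
    · rintro ⟨_, ⟨v, rfl⟩, hv⟩
      refine ⟨(v ∘ Sum.inl, v ∘ Sum.inr), hv ▸ ?_⟩
      ext i <;> simp [e, Matrix.fromBlocks_mulVec]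
    · rintro ⟨⟨v, w⟩, hv⟩
      refine ⟨_, ⟨Sum.elim v w, rfl⟩, hv ▸ ?_⟩
      ext i <;> simp [e, Matrix.fromBlocks_mulVec]
  have h2 (p : Submodule R (m → R)) (q : Submodule R (m' → R)) :
      Module.finrank R (p.prod q) = Module.finrank R p + Module.finrank R q := by
    rw [← Module.finrank_prod, ← LinearMap.finrank_range_of_inj (f := p.subtype.prodMap q.subtype)
      (p.injective_subtype.prodMap q.injective_subtype), LinearMap.range_prodMap,
      p.range_subtype, q.range_subtype]
  refine (LinearEquiv.finrank_map_eq e _).symm.trans ?_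
  rw [h, LinearMap.range_prodMap, h2]
  rfl

lemma rank_fromBlocks_zero [CommRing R] [IsDomain R] [Finite m] [Finite m'] [Fintype n]
    [Fintype n'] (A : Matrix m n R) (D : Matrix m' n' R) :
    (Matrix.fromBlocks A 0 0 D).rank = A.rank + D.rank := by
  rw [← rank_map_algebraMap (FractionRing R), ← rank_map_algebraMap (FractionRing R) A,
    ← rank_map_algebraMap (FractionRing R) D, Matrix.fromBlocks_map,
    ← rank_fromBlocks_zero_of_field]
  simp

lemma span_range_le_of_forall {V : Type*} [Semiring R] [AddCommMonoid V] [Module R V]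
    {a : n → V} {b : n' → V} (h : ∀ j, a j = 0 ∨ ∃ k, b k = a j) :
    Submodule.span R (Set.range a) ≤ Submodule.span R (Set.range b) := by
  refine Submodule.span_le.2 ?_
  rintro _ ⟨j, rfl⟩
  obtain h | ⟨k, h⟩ := h j
  · exact h ▸ Submodule.zero_mem _
  · exact h ▸ Submodule.subset_span ⟨k, rfl⟩

/-- Two matrices with the same nonzero columns have the same rank. -/
lemma rank_eq_of_col [CommRing R] [Fintype n] [Fintype n'] {A : Matrix m n R}
    {B : Matrix m n' R} (hA : ∀ j, A.col j = 0 ∨ ∃ k, B.col k = A.col j)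
    (hB : ∀ k, B.col k = 0 ∨ ∃ j, A.col j = B.col k) : A.rank = B.rank := by
  rw [Matrix.rank_eq_finrank_span_cols, Matrix.rank_eq_finrank_span_cols,
    le_antisymm (span_range_le_of_forall hA) (span_range_le_of_forall hB)]

end Rank

/-! ### Stacked trajectories -/

section Col

variable {m m' n n' : Type*}

lemma col_eq_zero {x : Traj n} {y : Traj n'} : col x y = 0 ↔ x = 0 ∧ y = 0 := by
  constructor
  · intro h
    exact ⟨funext fun t => funext fun i => congrFun (congrFun h t) (Sum.inl i),
      funext fun t => funext fun i => congrFun (congrFun h t) (Sum.inr i)⟩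
  · rintro ⟨rfl, rfl⟩
    funext t i
    rcases i with i | i <;> rfl

lemma col_add_col (x x' : Traj n) (y y' : Traj n') :
    col x y + col x' y' = col (x + x') (y + y') := by
  funext t i
  rcases i with i | i <;> rfl

lemma exists_eq_col (v : Traj (n ⊕ n')) : ∃ x y, v = col x y :=
  ⟨fun t i => v t (Sum.inl i), fun t i => v t (Sum.inr i), by
    funext t i
    rcases i with i | i <;> rfl⟩

lemma col_inj {x x' : Traj n} {y y' : Traj n'} : col x y = col x' y' ↔ x = x' ∧ y = y' := by
  constructor
  · intro h
    exact ⟨funext fun t => funext fun i => congrFun (congrFun h t) (Sum.inl i),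
      funext fun t => funext fun i => congrFun (congrFun h t) (Sum.inr i)⟩
  · rintro ⟨rfl, rfl⟩
    rfl

variable [Fintype n] [Fintype n']

lemma contDiff_col {x : Traj n} {y : Traj n'} :
    ContDiff ℝ ∞ (col x y) ↔ ContDiff ℝ ∞ x ∧ ContDiff ℝ ∞ y := by
  simp only [contDiff_pi, Sum.forall]
  rfl

lemma diffOp_fromCols (A : Matrix m n ℝ[X]) (B : Matrix m n' ℝ[X]) (x : Traj n) (y : Traj n') :
    diffOp (Matrix.fromCols A B) (col x y) = diffOp A x + diffOp B y := by
  funext t i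
  simp [diffOp, col]

lemma diffOp_fromRows (A : Matrix m n ℝ[X]) (B : Matrix m' n ℝ[X]) (x : Traj n) :
    diffOp (Matrix.fromRows A B) x = col (diffOp A x) (diffOp B x) := by
  funext t i
  rcases i with i | i <;> rfl

lemma diffOp_zero (x : Traj n) : diffOp (0 : Matrix m n ℝ[X]) x = 0 := by
  funext t i
  simp [diffOp]

end Col

/-! ### Controllers and their interconnection as projected kernel behaviors -/

section Controller

variable {g h γ σ κ ν g₁ g₂ h₁ h₂ γ₁ γ₂ ν₁ ν₂ : Type*} [Fintype γ] [Fintype σ] [Fintype κ]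
  [Fintype ν] [Fintype γ₁] [Fintype γ₂] [Fintype ν₁] [Fintype ν₂]

lemma canonicalController_eq (R : Matrix g ν ℝ[X]) (S : Matrix g σ ℝ[X]) (M : Matrix g γ ℝ[X])
    (W : Matrix h ν ℝ[X]) (K : Matrix h κ ℝ[X]) :
    canonicalController (kernelBehavior (Matrix.fromCols R (Matrix.fromCols S M)))
        (kernelBehavior (Matrix.fromCols W K)) =
      projBehavior (Matrix.fromCols
        (Matrix.fromRows (Matrix.fromCols M (Matrix.fromCols S 0))
          (Matrix.fromCols 0 (Matrix.fromCols 0 K)))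
        (Matrix.fromRows R W)) := by
  ext v
  obtain ⟨c, v, rfl⟩ := exists_eq_col v
  obtain ⟨s, k, rfl⟩ := exists_eq_col v
  simp only [canonicalController, projBehavior, kernelBehavior, Set.mem_ofPred_eq, col_inj,
    contDiff_col, diffOp_fromCols, diffOp_fromRows, diffOp_zero, add_zero, zero_add]
  simp only [col_add_col, col_eq_zero]
  constructor
  · rintro ⟨c', s', k', w, ⟨rfl, rfl, rfl⟩, ⟨⟨hw, hs, hc⟩, h1⟩, ⟨-, hk⟩, h2⟩
    exact ⟨w, ⟨⟨hc, hs, hk⟩, hw⟩, by rw [← h1]; abel, by rw [← h2]; abel⟩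
  · rintro ⟨w, ⟨⟨hc, hs, hk⟩, hw⟩, h1, h2⟩
    exact ⟨c, s, k, w, ⟨rfl, rfl, rfl⟩, ⟨⟨hw, hs, hc⟩, by rw [← h1]; abel⟩, ⟨hw, hk⟩,
      by rw [← h2]; abel⟩

/-- The local variables `w₁` and `w₂` are independent witnesses, so together they are the latent
variable of the stacked system; only `(s, k)` is shared. -/
lemma interconnection_eq (R₁ : Matrix g₁ ν₁ ℝ[X]) (S₁ : Matrix g₁ σ ℝ[X])
    (M₁ : Matrix g₁ γ₁ ℝ[X]) (W₁ : Matrix h₁ ν₁ ℝ[X]) (K₁ : Matrix h₁ κ ℝ[X])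
    (R₂ : Matrix g₂ ν₂ ℝ[X]) (S₂ : Matrix g₂ σ ℝ[X])
    (M₂ : Matrix g₂ γ₂ ℝ[X]) (W₂ : Matrix h₂ ν₂ ℝ[X]) (K₂ : Matrix h₂ κ ℝ[X]) :
    interconnection
        (canonicalController (kernelBehavior (Matrix.fromCols R₁ (Matrix.fromCols S₁ M₁)))
          (kernelBehavior (Matrix.fromCols W₁ K₁)))
        (canonicalController (kernelBehavior (Matrix.fromCols R₂ (Matrix.fromCols S₂ M₂)))
          (kernelBehavior (Matrix.fromCols W₂ K₂))) =
      projBehavior (Matrix.fromCols (Matrix.fromRows (blockL₁ M₁ S₁ K₁) (blockL₂ M₂ S₂ K₂))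
        (Matrix.fromRows (blockN₁ R₁ W₁) (blockN₂ R₂ W₂))) := by
  ext v
  obtain ⟨c₁, v, rfl⟩ := exists_eq_col v
  obtain ⟨c₂, v, rfl⟩ := exists_eq_col v
  obtain ⟨s, k, rfl⟩ := exists_eq_col v
  constructor
  · rintro ⟨c₁', c₂', v, hv, ⟨c₁'', s₁, k₁, w₁, hv₁, hP₁, hK₁⟩, ⟨c₂'', s₂, k₂, w₂, hv₂, hP₂, hK₂⟩⟩
    simp only [col_inj] at hv hv₁ hv₂
    obtain ⟨rfl, rfl, rfl⟩ := hv
    obtain ⟨rfl, hv₁⟩ := hv₁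
    obtain ⟨rfl, rfl, rfl⟩ : c₂ = c₂'' ∧ s = s₂ ∧ k = k₂ := by simpa [col_inj] using hv₂
    obtain ⟨rfl, rfl⟩ := col_inj.1 hv₁
    simp only [kernelBehavior, Set.mem_ofPred_eq, contDiff_col, diffOp_fromCols] at hP₁ hK₁ hP₂ hK₂
    refine ⟨col w₁ w₂, ?_⟩
    simp only [kernelBehavior, Set.mem_ofPred_eq, contDiff_col, diffOp_fromCols, diffOp_fromRows,
      blockL₁, blockL₂, blockN₁, blockN₂, ← Matrix.fromRows_fromCols_eq_fromBlocks, diffOp_zero,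
      add_zero, zero_add, col_add_col, col_eq_zero]
    obtain ⟨⟨hw₁, hs, hc₁⟩, h1⟩ := hP₁
    obtain ⟨⟨hw₂, -, hc₂⟩, h2⟩ := hP₂
    exact ⟨⟨⟨hc₁, hc₂, hs, hK₁.1.2⟩, hw₁, hw₂⟩, ⟨by rw [← h1]; abel, by rw [← hK₁.2]; abel⟩,
      by rw [← h2]; abel, by rw [← hK₂.2]; abel⟩
  · rintro ⟨w, hw⟩
    obtain ⟨w₁, w₂, rfl⟩ := exists_eq_col w
    simp only [kernelBehavior, Set.mem_ofPred_eq, contDiff_col, diffOp_fromCols, diffOp_fromRows,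
      blockL₁, blockL₂, blockN₁, blockN₂, ← Matrix.fromRows_fromCols_eq_fromBlocks, diffOp_zero,
      add_zero, zero_add, col_add_col, col_eq_zero] at hw
    obtain ⟨⟨⟨hc₁, hc₂, hs, hk⟩, hw₁, hw₂⟩, ⟨h1, h2⟩, h3, h4⟩ := hw
    refine ⟨c₁, c₂, col s k, rfl, ⟨c₁, s, k, w₁, rfl, ?_, ?_⟩, ⟨c₂, s, k, w₂, rfl, ?_, ?_⟩⟩ <;>
    simp only [kernelBehavior, Set.mem_ofPred_eq, contDiff_col, diffOp_fromCols]
    · exact ⟨⟨hw₁, hs, hc₁⟩, by rw [← h1]; abel⟩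
    · exact ⟨⟨hw₁, hk⟩, by rw [← h2]; abel⟩
    · exact ⟨⟨hw₂, hs, hc₂⟩, by rw [← h3]; abel⟩
    · exact ⟨⟨hw₂, hk⟩, by rw [← h4]; abel⟩

/-- Both matrices have the same nonzero columns; the blocks belonging to `c₂` and `w₂` are zero. -/
lemma rank_fromCols_block₁ (R : Matrix g ν₁ ℝ[X]) (S : Matrix g σ ℝ[X]) (M : Matrix g γ₁ ℝ[X])
    (W : Matrix h ν₁ ℝ[X]) (K : Matrix h κ ℝ[X]) :
    (Matrix.fromCols (blockL₁ (γ₂ := γ₂) M S K) (blockN₁ (ν₂ := ν₂) R W)).rank =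
      (Matrix.fromCols (Matrix.fromRows (Matrix.fromCols M (Matrix.fromCols S 0))
        (Matrix.fromCols 0 (Matrix.fromCols 0 K))) (Matrix.fromRows R W)).rank := by
  refine rank_eq_of_col ?_ ?_
  · rintro ((j | j | j | j) | j | j)
    · exact .inr ⟨.inl (.inl j), by ext (i | i) <;> rfl⟩
    · exact .inl (by ext (i | i) <;> rfl)
    · exact .inr ⟨.inl (.inr (.inl j)), by ext (i | i) <;> rfl⟩
    · exact .inr ⟨.inl (.inr (.inr j)), by ext (i | i) <;> rfl⟩
    · exact .inr ⟨.inr j, by ext (i | i) <;> rfl⟩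
    · exact .inl (by ext (i | i) <;> rfl)
  · rintro ((j | j | j) | j)
    · exact .inr ⟨.inl (.inl j), by ext (i | i) <;> rfl⟩
    · exact .inr ⟨.inl (.inr (.inr (.inl j))), by ext (i | i) <;> rfl⟩
    · exact .inr ⟨.inl (.inr (.inr (.inr j))), by ext (i | i) <;> rfl⟩
    · exact .inr ⟨.inr (.inl j), by ext (i | i) <;> rfl⟩

lemma rank_fromCols_block₂ (R : Matrix g ν₂ ℝ[X]) (S : Matrix g σ ℝ[X]) (M : Matrix g γ₂ ℝ[X])
    (W : Matrix h ν₂ ℝ[X]) (K : Matrix h κ ℝ[X]) :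
    (Matrix.fromCols (blockL₂ (γ₁ := γ₁) M S K) (blockN₂ (ν₁ := ν₁) R W)).rank =
      (Matrix.fromCols (Matrix.fromRows (Matrix.fromCols M (Matrix.fromCols S 0))
        (Matrix.fromCols 0 (Matrix.fromCols 0 K))) (Matrix.fromRows R W)).rank := by
  refine rank_eq_of_col ?_ ?_
  · rintro ((j | j | j | j) | j | j)
    · exact .inl (by ext (i | i) <;> rfl)
    · exact .inr ⟨.inl (.inl j), by ext (i | i) <;> rfl⟩
    · exact .inr ⟨.inl (.inr (.inl j)), by ext (i | i) <;> rfl⟩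
    · exact .inr ⟨.inl (.inr (.inr j)), by ext (i | i) <;> rfl⟩
    · exact .inl (by ext (i | i) <;> rfl)
    · exact .inr ⟨.inr j, by ext (i | i) <;> rfl⟩
  · rintro ((j | j | j) | j)
    · exact .inr ⟨.inl (.inr (.inl j)), by ext (i | i) <;> rfl⟩
    · exact .inr ⟨.inl (.inr (.inr (.inl j))), by ext (i | i) <;> rfl⟩
    · exact .inr ⟨.inl (.inr (.inr (.inr j))), by ext (i | i) <;> rfl⟩
    · exact .inr ⟨.inr (.inr j), by ext (i | i) <;> rfl⟩

lemma rank_fromRows_blockN [Finite g₁] [Finite h₁] [Finite g₂] [Finite h₂]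
    (R₁ : Matrix g₁ ν₁ ℝ[X]) (W₁ : Matrix h₁ ν₁ ℝ[X])
    (R₂ : Matrix g₂ ν₂ ℝ[X]) (W₂ : Matrix h₂ ν₂ ℝ[X]) :
    (Matrix.fromRows (blockN₁ R₁ W₁) (blockN₂ R₂ W₂)).rank =
      (Matrix.fromRows R₁ W₁).rank + (Matrix.fromRows R₂ W₂).rank := by
  rw [← rank_fromBlocks_zero]
  congr 1
  ext ((i | i) | i | i) (j | j) <;> rfl

end Controller

end Behavioral

theorem mainTheorem4
    {nw₁ nw₂ ns nk nc₁ nc₂ g₁ g₂ h₁ h₂ : ℕ}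
    (P₁ : Set (Behavioral.Traj (Fin nw₁ ⊕ Fin ns ⊕ Fin nc₁)))
    (P₂ : Set (Behavioral.Traj (Fin nw₂ ⊕ Fin ns ⊕ Fin nc₂)))
    (𝒦₁ : Set (Behavioral.Traj (Fin nw₁ ⊕ Fin nk)))
    (𝒦₂ : Set (Behavioral.Traj (Fin nw₂ ⊕ Fin nk)))
    (R₁ : Matrix (Fin g₁) (Fin nw₁) ℝ[X]) (S₁ : Matrix (Fin g₁) (Fin ns) ℝ[X])
    (M₁ : Matrix (Fin g₁) (Fin nc₁) ℝ[X])
    (R₂ : Matrix (Fin g₂) (Fin nw₂) ℝ[X]) (S₂ : Matrix (Fin g₂) (Fin ns) ℝ[X])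
    (M₂ : Matrix (Fin g₂) (Fin nc₂) ℝ[X])
    (W₁ : Matrix (Fin h₁) (Fin nw₁) ℝ[X]) (K₁ : Matrix (Fin h₁) (Fin nk) ℝ[X])
    (W₂ : Matrix (Fin h₂) (Fin nw₂) ℝ[X]) (K₂ : Matrix (Fin h₂) (Fin nk) ℝ[X])
    (hP₁ : P₁ = Behavioral.kernelBehavior (Matrix.fromCols R₁ (Matrix.fromCols S₁ M₁)))
    (hP₂ : P₂ = Behavioral.kernelBehavior (Matrix.fromCols R₂ (Matrix.fromCols S₂ M₂)))
    (hK₁ : 𝒦₁ = Behavioral.kernelBehavior (Matrix.fromCols W₁ K₁))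
    (hK₂ : 𝒦₂ = Behavioral.kernelBehavior (Matrix.fromCols W₂ K₂)) :
    Behavioral.IsRegularInterconnection
        (Behavioral.canonicalController P₁ 𝒦₁) (Behavioral.canonicalController P₂ 𝒦₂) ↔
      (Matrix.fromCols (Behavioral.blockL₁ (γ₂ := Fin nc₂) M₁ S₁ K₁)
          (Behavioral.blockN₁ (ν₂ := Fin nw₂) R₁ W₁)).rank +
        (Matrix.fromCols (Behavioral.blockL₂ (γ₁ := Fin nc₁) M₂ S₂ K₂)
          (Behavioral.blockN₂ (ν₁ := Fin nw₁) R₂ W₂)).rank =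
      (Matrix.fromRows
        (Matrix.fromCols (Behavioral.blockL₁ (γ₂ := Fin nc₂) M₁ S₁ K₁)
          (Behavioral.blockN₁ (ν₂ := Fin nw₂) R₁ W₁))
        (Matrix.fromCols (Behavioral.blockL₂ (γ₁ := Fin nc₁) M₂ S₂ K₂)
          (Behavioral.blockN₂ (ν₁ := Fin nw₁) R₂ W₂))).rank := by
  subst hP₁ hP₂ hK₁ hK₂
  have hrows : Matrix.fromRows
      (Matrix.fromCols (Behavioral.blockL₁ (γ₂ := Fin nc₂) M₁ S₁ K₁)
        (Behavioral.blockN₁ (ν₂ := Fin nw₂) R₁ W₁))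
      (Matrix.fromCols (Behavioral.blockL₂ (γ₁ := Fin nc₁) M₂ S₂ K₂)
        (Behavioral.blockN₂ (ν₁ := Fin nw₁) R₂ W₂)) =
      Matrix.fromCols
        (Matrix.fromRows (Behavioral.blockL₁ M₁ S₁ K₁) (Behavioral.blockL₂ M₂ S₂ K₂))
        (Matrix.fromRows (Behavioral.blockN₁ R₁ W₁) (Behavioral.blockN₂ R₂ W₂)) := by
    ext (i | i) (j | j) <;> rfl
  -- Each rank of `[L N]` becomes an output cardinality plus the rank of its `N`; the ranks of `N`
  -- agree on both sides and cancel.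
  rw [Behavioral.IsRegularInterconnection, Behavioral.interconnection_eq,
    Behavioral.canonicalController_eq, Behavioral.canonicalController_eq, hrows,
    Behavioral.rank_fromCols_block₁, Behavioral.rank_fromCols_block₂,
    ← Behavioral.outputCard_projBehavior_add, ← Behavioral.outputCard_projBehavior_add,
    ← Behavioral.outputCard_projBehavior_add, Behavioral.rank_fromRows_blockN]
  omega
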